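/- Let $\mathbb K$ be a field, $n$ a positive integer, $[x]$ the free commutative monoid of monomials in $x_1,\dots,x_n$, and $\mathbb K[[x]]=\mathbb K[[x_1,\dots,x_n]]$. For $f\in\mathbb K[[x]]$ and a monomial $M$ let $\langle f|M\rangle$ be the coefficient of $M$ in $f$, and $\operatorname{supp}(f)=\{M:\langle f|M\rangle\neq 0\}$. Equip $\mathbb K[[x]]$ with the metric $\delta(f,g)=2^{-\operatorname{val}(f-g)}$, where $\operatorname{val}(h)$ is the smallest total degree of a monomial in $\operatorname{supp}(h)$ and $\operatorname{val}(0)=\infty$ (so $\delta(f,f)=0$). Let $<$ be an admissible monomial order on $[x]$ (a total order, compatible with multiplication, with $1\le m$ for all $m$; equivalently, a multiplicative well-order) that is compatible with the degree, i.e. $\deg m_1<\deg m_2$ implies $m_1<m_2$. For $f\neq 0$ let $\mathrm{LM}(f)$ be the $<$-least monomial of $\operatorname{supp}(f)$ and $\mathrm{LC}(f)$ its coefficient in $f$. Let $R=\{s_1,\dots,s_r\}$ ($r\ge 0$) be a finite set of $r$ nonzero elements of $\mathbb K[[x]]$ and let $I(R)$ be the ideal that it generates. Write $f\to g$ if there are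 $M\in\operatorname{supp}(f)$, an index $i$ and a monomial $m$ with $M=m\cdot\mathrm{LM}(s_i)$ and $g=f-\frac{\langle f|M\rangle}{\mathrm{LC}(s_i)}\,m\,s_i$. Let $\to^{*}$ be the reflexive transitive closure of $\to$. Let $\to^{\mathrm{top}}$ be the closure of $\to^{*}$ in $\mathbb K[[x]]\times\mathbb K[[x]]$, where the first factor is discrete and the second carries the topology of $\delta$. Write $f\to^{\mathrm{ch}} g$ ("$f$ rewrites to $g$ by chains") if there is a sequence $(h_k)_{k\in\mathbb N}$ with $h_0=f$, with $h_k=h_{k+1}$ or $h_k\to h_{k+1}$ for every $k$, and with $h_k$ converging to $g$ for $\delta$. A normal form is an $f$ for which there is no $g$ with $f\to g$; let $\mathrm{NF}$ be the set of normal forms. The system is finitary (resp. infinitary) topologically confluent if, whenever $a\to^{*}b$ and $a\to^{*}c$ (resp. $a\to^{\mathrm{top}}b$ and $a\to^{\mathrm{top}}c$), there is $d$ with $b\to^{\mathrm{top}}d$ and $c\to^{\mathrm{top}}d$. A subset $G\subseteq I\setminus\{0\}$ is a standard basis of an ideal $I$ if for every $f\in I\setminus\{0\}$ there are $g\in G$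 and a monomial $m$ with $\mathrm{LM}(f)=m\cdot\mathrm{LM}(g)$. A nonzero $f$ has a standard representation with respect to $R$ if $f=\sum_{i=1}^r q_is_i$ for some $q_i\in\mathbb K[[x]]$ with $\mathrm{LM}(f)=\min_<\{\mathrm{LM}(q_is_i): q_i\neq0\}$. Theorem. The following statements are equivalent: 1. the system is finitary topologically confluent; 2. $f\to^{\mathrm{top}}0$ for every $f\in I(R)$; 3. every $f\in I(R)\setminus\{0\}$ is reducible (not a normal form); 4. $R$ is a standard basis of $I(R)$; 5. $f\to^{\mathrm{ch}}0$ for every $f\in I(R)$; 6. every $f\in I(R)\setminus\{0\}$ has a standard representation with respect to $R$; 7. for every $f\in\mathbb K[[x]]$ there is a unique $\alpha\in\mathrm{NF}$ such that $f=\alpha+\sum_{i=1}^r q_is_i$ for some $(q_1,\dots,q_r)\in\mathbb K[[x]]^r$; 8. the map $\mathrm{NF}\to\mathbb K[[x]]/I(R)$, $\alpha\mapsto\alpha+I(R)$, is bijective; 9. the system is infinitary topologically confluent. -/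

import Mathlib

/-! ### Topological rewriting systems -/

/-- An abstract topological rewriting system on `X`: a topology together with an arbitrary binary
relation, the one-step reduction. -/
structure TopRewritingSystem (X : Type*) where
  /-- the topology -/
  top : TopologicalSpace X
  /-- the one-step reduction relation -/
  step : X → X → Prop

namespace TopRewritingSystem

variable {X : Type*} (S : TopRewritingSystem X)

/-- The reflexive transitive closure of the one-step reduction. -/
def FinRew : X → X → Prop := Relation.ReflTransGen S.step

/-- The topological rewriting relation: the closure of `FinRew`, as a subset of `X × X`, for the
product of the discrete topology `⊥` (first factor) and the topology of the system (second
factor). -/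
def TopRew (a b : X) : Prop :=
  (a, b) ∈ @closure (X × X) (@instTopologicalSpaceProd X X ⊥ S.top) {p | S.FinRew p.1 p.2}

/-- Topological rewriting with chains: `b` is the limit of a sequence starting at `a`, each term of
which is equal to the previous one or obtained from it by one reduction step. -/
def ChainRew (a b : X) : Prop :=
  ∃ h : ℕ → X, h 0 = a ∧ (∀ k, h k = h (k + 1) ∨ S.step (h k) (h (k + 1))) ∧
    Filter.Tendsto h Filter.atTop (@nhds X S.top b)

/-- Normal forms: elements that cannot be reduced. -/
def NormalForms : Set X := {a | ¬ ∃ b, S.step a b}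

/-- Finitary topological confluence. -/
def FinitaryTopConfluent : Prop :=
  ∀ a b c, S.FinRew a b → S.FinRew a c → ∃ d, S.TopRew b d ∧ S.TopRew c d

/-- Infinitary topological confluence. -/
def InfinitaryTopConfluent : Prop :=
  ∀ a b c, S.TopRew a b → S.TopRew a c → ∃ d, S.TopRew b d ∧ S.TopRew c d

end TopRewritingSystem

/-! ### Formal power series -/

namespace StdBasis

open MvPowerSeries

variable {K : Type*} [Field K] {n : ℕ}

/-- The distance `δ(f, g) = 2 ^ (-val (f - g))`, where `val h` is the smallest total degree of a
monomial in the support of `h`; it is `0` when `f = g`. -/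
noncomputable def delta (f g : MvPowerSeries (Fin n) K) : ℝ :=
  open Classical in if f = g then 0 else (1 / 2 : ℝ) ^ (f - g).order.toNat

theorem delta_self (f : MvPowerSeries (Fin n) K) : delta f f = 0 := by
  simp [delta]

theorem delta_comm (f g : MvPowerSeries (Fin n) K) : delta f g = delta g f := by
  by_cases h : f = g
  · rw [h]
  · simp only [delta, h, Ne.symm h, if_false]
    rw [← neg_sub g f, order_neg]

theorem eq_of_delta_eq_zero {f g : MvPowerSeries (Fin n) K} (h : delta f g = 0) : f = g := by
  by_contra hne
  simp [delta, hne] at h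

theorem delta_nonneg (f g : MvPowerSeries (Fin n) K) : 0 ≤ delta f g := by
  unfold delta
  split_ifs <;> positivity

theorem delta_le_max (f g h : MvPowerSeries (Fin n) K) :
    delta f h ≤ max (delta f g) (delta g h) := by
  by_cases hfg : f = g
  · subst hfg; exact le_max_right _ _
  by_cases hgh : g = h
  · subst hgh; exact le_max_left _ _
  by_cases hfh : f = h
  · subst hfh; rw [delta_self]; exact le_max_of_le_left (delta_nonneg _ _)
  have h1 : (f - g).order.toNat = (f - g).order :=
    ne_zero_iff_order_finite.mp (sub_ne_zero.mpr hfg)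
  have h2 : (g - h).order.toNat = (g - h).order :=
    ne_zero_iff_order_finite.mp (sub_ne_zero.mpr hgh)
  have h3 : (f - h).order.toNat = (f - h).order :=
    ne_zero_iff_order_finite.mp (sub_ne_zero.mpr hfh)
  have key : min (f - g).order (g - h).order ≤ (f - h).order := by
    simpa using min_order_le_add (f := f - g) (g := g - h)
  rw [← h1, ← h2, ← h3, min_le_iff] at key
  simp only [delta, hfg, hgh, hfh, if_false]
  rcases key with key | key
  · exact le_max_of_le_left
      (pow_le_pow_of_le_one (by norm_num) (by norm_num) (Nat.cast_le.mp key))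
  · exact le_max_of_le_right
      (pow_le_pow_of_le_one (by norm_num) (by norm_num) (Nat.cast_le.mp key))

/-- The metric space `(K[[x₁, …, xₙ]], δ)`. -/
noncomputable abbrev deltaMetric (K : Type*) [Field K] (n : ℕ) :
    MetricSpace (MvPowerSeries (Fin n) K) where
  dist := delta
  dist_self := delta_self
  dist_comm := delta_comm
  dist_triangle f g h := (delta_le_max f g h).trans
    (max_le_add_of_nonneg (delta_nonneg _ _) (delta_nonneg _ _))
  eq_of_dist_eq_zero := eq_of_delta_eq_zero

/-- The topology induced by the metric `δ`. -/
noncomputable abbrev deltaTopology (K : Type*) [Field K] (n : ℕ) :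
    TopologicalSpace (MvPowerSeries (Fin n) K) :=
  (deltaMetric K n).toUniformSpace.toTopologicalSpace

/-- Compatibility with the degree. Monomials are exponent vectors `Fin n →₀ ℕ`, written additively,
and are compared for the monomial order through `ord.toSyn`. -/
def DegreeCompatible (ord : MonomialOrder (Fin n)) : Prop :=
  ∀ a b : Fin n →₀ ℕ, a.degree < b.degree → ord.toSyn a < ord.toSyn b

/-- The leading monomial of a nonzero power series: the *least* monomial of its support for the
(admissible) monomial order. The value at `0` is a dummy value. -/
noncomputable def leadMon (ord : MonomialOrder (Fin n)) (f : MvPowerSeries (Fin n) K) :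
    Fin n →₀ ℕ :=
  open Classical in
  if h : {a : Fin n →₀ ℕ | coeff a f ≠ 0}.Nonempty then
    Function.argminOn ord.toSyn {a : Fin n →₀ ℕ | coeff a f ≠ 0} h
  else 0

/-- The leading coefficient. -/
noncomputable def leadCoeff (ord : MonomialOrder (Fin n)) (f : MvPowerSeries (Fin n) K) : K :=
  coeff (leadMon ord f) f

/-- The one-step reduction with respect to a set `R` of power series: a monomial `M` of the support
of `f` that is a multiple `a · LM(s)` of the leading monomial of some `s ∈ R` is eliminated by
subtracting the appropriate scalar multiple of `a · s`. -/
def Reduces (ord : MonomialOrder (Fin n)) (R : Set (MvPowerSeries (Fin n) K))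
    (f g : MvPowerSeries (Fin n) K) : Prop :=
  ∃ M : Fin n →₀ ℕ, coeff M f ≠ 0 ∧ ∃ s ∈ R, ∃ a : Fin n →₀ ℕ,
    M = a + leadMon ord s ∧
      g = f - (coeff M f / leadCoeff ord s) • (monomial a (1 : K) * s)

/-- The topological rewriting system on `K[[x₁, …, xₙ]]` induced by `R` and the monomial order. -/
noncomputable def system (ord : MonomialOrder (Fin n)) (R : Set (MvPowerSeries (Fin n) K)) :
    TopRewritingSystem (MvPowerSeries (Fin n) K) where
  top := deltaTopology K n
  step := Reduces ord R

/-- `G` is a standard basis of the ideal `I`. -/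
def IsStandardBasis (ord : MonomialOrder (Fin n)) (G : Set (MvPowerSeries (Fin n) K))
    (I : Ideal (MvPowerSeries (Fin n) K)) : Prop :=
  G ⊆ (I : Set (MvPowerSeries (Fin n) K)) \ {0} ∧
    ∀ f ∈ I, f ≠ 0 → ∃ g ∈ G, ∃ a : Fin n →₀ ℕ, leadMon ord f = a + leadMon ord g

/-- `f` has a standard representation with respect to `R`: `f = ∑ qₛ s`, and the leading monomial
of `f` is the least of the leading monomials of the products `qₛ s` with `qₛ ≠ 0`. -/
def HasStandardRep (ord : MonomialOrder (Fin n)) (R : Finset (MvPowerSeries (Fin n) K))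
    (f : MvPowerSeries (Fin n) K) : Prop :=
  ∃ q : R → MvPowerSeries (Fin n) K, f = ∑ s : R, q s * (s : MvPowerSeries (Fin n) K) ∧
    IsLeast {x : ord.syn | ∃ s : R, q s ≠ 0 ∧
      x = ord.toSyn (leadMon ord (q s * (s : MvPowerSeries (Fin n) K)))}
      (ord.toSyn (leadMon ord f))

end StdBasis

namespace StdBasis

open MvPowerSeries

variable {K : Type*} [Field K] {n : ℕ}

/-! ### Leading monomials -/

/-! Only finitely many monomials have bounded degree, so a degree-compatible order has order type
`ω`. Two consequences carry the theorem.

Division (`exists_chainRew_normalForm`): visit the monomials in increasing order and cancel each one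
that is reducible. Treating a monomial never disturbs a smaller one, so every coefficient
stabilizes; the chain converges to a normal form, and the accumulated multipliers are genuine power
series `q s` with no product reaching below `LM(f)`. If no nonzero element of the ideal is a normal
form, the remainder of an ideal element is `0`, giving standard representations and rewriting to `0`
by chains.

Confluence (`exists_reducible_of_finitaryTopConfluent`): if two multiples of elements of `R` share
the leading monomial `M`, reducing the single monomial `M` by each and joining the results writes
the difference of the normalized multiples through multiples with leading monomial above `M`, up to
high order. This is Buchberger's argument: a representation of an ideal element can be pushed
upwards one monomial at a time, and pushing it past an irreducible leading monomial is absurd.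

Conversely, when leading monomials of the ideal are reducible, normal forms congruent up to every
order coincide (`eq_of_mem_normalForms`). This yields uniqueness of remainders and infinitary
confluence without showing that the ideal is closed. -/

theorem coeff_leadMon_ne_zero (ord : MonomialOrder (Fin n)) {f : MvPowerSeries (Fin n) K}
    (hf : f ≠ 0) : coeff (leadMon ord f) f ≠ 0 := by
  have h : {a : Fin n →₀ ℕ | coeff a f ≠ 0}.Nonempty := by
    by_contra hne
    rw [Set.not_nonempty_iff_eq_empty, Set.eq_empty_iff_forall_notMem] at hne
    exact hf (MvPowerSeries.ext fun a => by simpa using hne a)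
  rw [leadMon, dif_pos h]
  exact Function.argminOn_mem ord.toSyn _ h

theorem leadMon_le (ord : MonomialOrder (Fin n)) {f : MvPowerSeries (Fin n) K}
    {a : Fin n →₀ ℕ} (ha : coeff a f ≠ 0) : ord.toSyn (leadMon ord f) ≤ ord.toSyn a := by
  rw [leadMon, dif_pos ⟨a, ha⟩]
  exact Function.argminOn_le ord.toSyn {a : Fin n →₀ ℕ | coeff a f ≠ 0} ha

/-- The power series all of whose monomials are at least `L`. -/
def above (K : Type*) [Field K] (ord : MonomialOrder (Fin n)) (L : ord.syn) :
    Submodule K (MvPowerSeries (Fin n) K) where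
  carrier := {f | ∀ a, ord.toSyn a < L → coeff a f = 0}
  add_mem' hf hg a ha := by rw [map_add, hf a ha, hg a ha, add_zero]
  zero_mem' a _ := map_zero _
  smul_mem' c f hf a ha := by rw [coeff_smul, hf a ha, mul_zero]

theorem mem_above_leadMon (ord : MonomialOrder (Fin n)) (f : MvPowerSeries (Fin n) K) :
    f ∈ above K ord (ord.toSyn (leadMon ord f)) := fun a ha => by
  by_contra h
  exact (leadMon_le ord h).not_gt ha

theorem monomial_mem_above (ord : MonomialOrder (Fin n)) (a : Fin n →₀ ℕ) (c : K) :
    monomial a c ∈ above K ord (ord.toSyn a) := fun b hb =>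
  coeff_monomial_ne (fun h => hb.ne (by rw [h])) c

theorem above_antitone {ord : MonomialOrder (Fin n)} {L L' : ord.syn} (h : L ≤ L') :
    above K ord L' ≤ above K ord L := fun _ hf a ha => hf a (ha.trans_le h)

theorem mul_mem_above {ord : MonomialOrder (Fin n)} {L L' : ord.syn}
    {f g : MvPowerSeries (Fin n) K} (hf : f ∈ above K ord L) (hg : g ∈ above K ord L') :
    f * g ∈ above K ord (L + L') := fun a ha => by
  classical
  rw [coeff_mul]
  refine Finset.sum_eq_zero fun p hp => ?_
  rw [Finset.HasAntidiagonal.mem_antidiagonal] at hp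
  rcases lt_or_ge (ord.toSyn p.1) L with h | h
  · rw [hf _ h, zero_mul]
  rcases lt_or_ge (ord.toSyn p.2) L' with h' | h'
  · rw [hg _ h', mul_zero]
  rw [← hp, map_add] at ha
  exact absurd (add_le_add h h') ha.not_ge

theorem le_leadMon_of_mem_above {ord : MonomialOrder (Fin n)} {L : ord.syn}
    {f : MvPowerSeries (Fin n) K} (hf : f ≠ 0) (h : f ∈ above K ord L) :
    L ≤ ord.toSyn (leadMon ord f) := by
  by_contra hlt
  exact coeff_leadMon_ne_zero ord hf (h _ (not_le.mp hlt))

/-- A contributing pair of monomials dominates the two leading ones termwise and has the same sum,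
which forces equality in both places. -/
theorem coeff_mul_leadMon (ord : MonomialOrder (Fin n)) (f g : MvPowerSeries (Fin n) K) :
    coeff (leadMon ord f + leadMon ord g) (f * g) =
      coeff (leadMon ord f) f * coeff (leadMon ord g) g := by
  classical
  rw [coeff_mul]
  refine Finset.sum_eq_single (leadMon ord f, leadMon ord g) (fun p hp hne => ?_)
    fun h => absurd (by rw [Finset.HasAntidiagonal.mem_antidiagonal]) h
  rw [Finset.HasAntidiagonal.mem_antidiagonal] at hp
  by_contra h
  have h1 := leadMon_le ord (left_ne_zero_of_mul h)
  have h2 := leadMon_le ord (right_ne_zero_of_mul h)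
  have hs : ord.toSyn p.1 + ord.toSyn p.2 =
      ord.toSyn (leadMon ord f) + ord.toSyn (leadMon ord g) := by
    rw [← map_add, hp, map_add]
  obtain ⟨e1, e2⟩ := (add_eq_add_iff_eq_and_eq h1 h2).mp hs.symm
  exact hne (Prod.ext (ord.toSyn.injective e1.symm) (ord.toSyn.injective e2.symm))

theorem leadMon_mul (ord : MonomialOrder (Fin n)) {f g : MvPowerSeries (Fin n) K}
    (hf : f ≠ 0) (hg : g ≠ 0) : leadMon ord (f * g) = leadMon ord f + leadMon ord g := by
  apply ord.toSyn.injective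
  refine le_antisymm (leadMon_le ord ?_) ?_
  · rw [coeff_mul_leadMon]
    exact mul_ne_zero (coeff_leadMon_ne_zero ord hf) (coeff_leadMon_ne_zero ord hg)
  · rw [map_add]
    exact le_leadMon_of_mem_above (mul_ne_zero hf hg)
      (mul_mem_above (mem_above_leadMon ord f) (mem_above_leadMon ord g))

/-! ### Convergence for the metric `δ` -/

/-- The power series of order at least `N`. -/
def orderGE (K : Type*) [Field K] (n N : ℕ) : Submodule K (MvPowerSeries (Fin n) K) where
  carrier := {f | ∀ a, a.degree < N → coeff a f = 0}
  add_mem' hf hg a ha := by rw [map_add, hf a ha, hg a ha, add_zero]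
  zero_mem' a _ := map_zero _
  smul_mem' c f hf a ha := by rw [coeff_smul, hf a ha, mul_zero]

theorem delta_le_iff {N : ℕ} {f g : MvPowerSeries (Fin n) K} :
    delta f g ≤ (1 / 2 : ℝ) ^ N ↔ f - g ∈ orderGE K n N := by
  by_cases h : f = g
  · subst h
    simp [delta, (orderGE K n N).zero_mem]
  have h1 : (f - g).order.toNat = (f - g).order :=
    ne_zero_iff_order_finite.mp (sub_ne_zero.mpr h)
  rw [delta, if_neg h, pow_le_pow_iff_right_of_lt_one₀ (by norm_num) (by norm_num),
    ← Nat.cast_le (α := ℕ∞), h1]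
  exact ⟨fun hle a ha => coeff_of_lt_order ((Nat.cast_lt.mpr ha).trans_le hle),
    fun hm => nat_le_order hm⟩

theorem nhds_deltaTopology_hasBasis (f : MvPowerSeries (Fin n) K) :
    (@nhds _ (deltaTopology K n) f).HasBasis (fun _ : ℕ => True)
      fun N => {g | g - f ∈ orderGE K n N} := by
  let := deltaMetric K n
  have h := Metric.nhds_basis_closedBall_pow (x := f) (r := (1 / 2 : ℝ)) (by norm_num) (by norm_num)
  refine h.congr (fun _ => Iff.rfl) fun N _ => ?_
  ext g
  exact delta_le_iff

/-- As the first factor is discrete, the sets `{f} × ball` form a neighbourhood basis, so the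
closure is taken in the second variable alone. -/
theorem topRew_system_iff {ord : MonomialOrder (Fin n)} {R : Set (MvPowerSeries (Fin n) K)}
    {f g : MvPowerSeries (Fin n) K} :
    (system ord R).TopRew f g ↔
      ∀ N : ℕ, ∃ g', (system ord R).FinRew f g' ∧ g' - g ∈ orderGE K n N := by
  have hb : (@nhds (MvPowerSeries (Fin n) K × MvPowerSeries (Fin n) K)
      (@instTopologicalSpaceProd _ _ ⊥ (deltaTopology K n)) (f, g)).HasBasis
      (fun _ : Unit × ℕ => True ∧ True)
      fun i => {f} ×ˢ {g' | g' - g ∈ orderGE K n i.2} := by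
    rw [@nhds_prod_eq _ _ ⊥ (deltaTopology K n), @nhds_discrete _ ⊥ (@DiscreteTopology.mk _ ⊥ rfl)]
    exact (Filter.hasBasis_pure f).prod (nhds_deltaTopology_hasBasis g)
  refine (@mem_closure_iff_nhds_basis _ (@instTopologicalSpaceProd _ _ ⊥ (deltaTopology K n))
    _ _ _ _ _ hb).trans ?_
  constructor
  · intro h N
    obtain ⟨⟨x, y⟩, hxy, hx, hy⟩ := h ((), N) ⟨trivial, trivial⟩
    obtain rfl : x = f := hx
    exact ⟨y, hxy, hy⟩
  · rintro h ⟨-, N⟩ -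
    obtain ⟨g', h1, h2⟩ := h N
    exact ⟨(f, g'), h1, rfl, h2⟩

theorem FinRew.topRew {ord : MonomialOrder (Fin n)} {R : Set (MvPowerSeries (Fin n) K)}
    {f g : MvPowerSeries (Fin n) K} (h : (system ord R).FinRew f g) :
    (system ord R).TopRew f g :=
  topRew_system_iff.mpr fun N => ⟨g, h, by rw [sub_self]; exact zero_mem _⟩

theorem ChainRew.topRew {ord : MonomialOrder (Fin n)} {R : Set (MvPowerSeries (Fin n) K)}
    {f g : MvPowerSeries (Fin n) K} (h : (system ord R).ChainRew f g) :
    (system ord R).TopRew f g := by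
  obtain ⟨u, h0, hstep, hlim⟩ := h
  have hfin : ∀ k, (system ord R).FinRew f (u k) := by
    intro k
    induction k with
    | zero => rw [h0]; exact Relation.ReflTransGen.refl
    | succ k ih =>
      rcases hstep k with h | h
      · rwa [← h]
      · exact ih.tail h
  refine topRew_system_iff.mpr fun N => ?_
  obtain ⟨k, hk⟩ := (((nhds_deltaTopology_hasBasis g).tendsto_right_iff.mp hlim) N trivial).exists
  exact ⟨u k, hfin k, hk⟩

/-! ### Degree-compatible orders have order type `ω` -/

theorem degree_le_of_toSyn_le {ord : MonomialOrder (Fin n)} (hord : DegreeCompatible ord)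
    {a b : Fin n →₀ ℕ} (h : ord.toSyn a ≤ ord.toSyn b) : a.degree ≤ b.degree := by
  by_contra hlt
  exact (hord b a (not_le.mp hlt)).not_ge h

/-- Intervals are finite because degrees below a given monomial are bounded; multiplying by a
variable, available since `0 < n`, rules out a maximum. -/
theorem exists_orderIso_nat (hn : 0 < n) {ord : MonomialOrder (Fin n)}
    (hord : DegreeCompatible ord) : Nonempty (ℕ ≃o ord.syn) := by
  let : LocallyFiniteOrder ord.syn := LocallyFiniteOrder.ofFiniteIcc fun a b => by
    refine ((Finsupp.finite_of_degree_le (ord.toSyn.symm b).degree).image ord.toSyn).subset ?_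
    intro x hx
    refine ⟨ord.toSyn.symm x, ?_, by simp⟩
    exact degree_le_of_toSyn_le hord (by simpa using hx.2)
  let := LinearLocallyFiniteOrder.succOrder ord.syn
  let := LinearLocallyFiniteOrder.predOrder ord.syn
  have : NoMaxOrder ord.syn := ⟨fun x => by
    refine ⟨ord.toSyn (ord.toSyn.symm x + Finsupp.single ⟨0, hn⟩ 1), ?_⟩
    have h := hord (ord.toSyn.symm x) (ord.toSyn.symm x + Finsupp.single ⟨0, hn⟩ 1) (by simp)
    simpa using h⟩
  exact ⟨orderIsoNatOfLinearSuccPredArch.symm⟩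

theorem apply_add_one_le_iff {α : Type*} [LinearOrder α] (e : ℕ ≃o α) (k : ℕ) (x : α) :
    e (k + 1) ≤ x ↔ e k < x := by
  obtain ⟨i, rfl⟩ := e.surjective x
  rw [e.le_iff_le, e.lt_iff_lt, Nat.succ_le_iff]

theorem above_le_orderGE (hn : 0 < n) {ord : MonomialOrder (Fin n)} (hord : DegreeCompatible ord)
    (N : ℕ) : above K ord (ord.toSyn (Finsupp.single ⟨0, hn⟩ N)) ≤ orderGE K n N :=
  fun _ hf a ha => hf a (hord _ _ (by simpa using ha))

/-! ### Reducible monomials -/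

/-- The monomial `M` is a multiple of the leading monomial of some element of `R`. -/
def Reducible (ord : MonomialOrder (Fin n)) (R : Set (MvPowerSeries (Fin n) K))
    (M : Fin n →₀ ℕ) : Prop :=
  ∃ s ∈ R, ∃ a : Fin n →₀ ℕ, M = a + leadMon ord s

theorem mem_normalForms_iff {ord : MonomialOrder (Fin n)} {R : Set (MvPowerSeries (Fin n) K)}
    {f : MvPowerSeries (Fin n) K} :
    f ∈ (system ord R).NormalForms ↔ ∀ M, Reducible ord R M → coeff M f = 0 := by
  constructor
  · rintro h M ⟨s, hs, a, ha⟩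
    by_contra hM
    exact h ⟨_, M, hM, s, hs, a, ha, rfl⟩
  · rintro h ⟨g, M, hM, s, hs, a, ha, -⟩
    exact hM (h M ⟨s, hs, a, ha⟩)

theorem monomial_mul_mem_above (ord : MonomialOrder (Fin n)) (a : Fin n →₀ ℕ) (c : K)
    (s : MvPowerSeries (Fin n) K) :
    monomial a c * s ∈ above K ord (ord.toSyn (a + leadMon ord s)) := by
  rw [map_add]
  exact mul_mem_above (monomial_mem_above ord a c) (mem_above_leadMon ord s)

theorem sub_mem_span_of_finRew {ord : MonomialOrder (Fin n)} {R : Set (MvPowerSeries (Fin n) K)}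
    {f g : MvPowerSeries (Fin n) K} (h : (system ord R).FinRew f g) : f - g ∈ Ideal.span R := by
  induction h with
  | refl => rw [sub_self]; exact zero_mem _
  | tail _ hs ih =>
    obtain ⟨M, -, s, hs, a, -, rfl⟩ := hs
    rw [← sub_add]
    refine add_mem ih ?_
    rw [smul_eq_C_mul]
    exact Ideal.mul_mem_left _ _ (Ideal.mul_mem_left _ _ (Ideal.subset_span hs))

theorem mem_span_iff_exists_sum {R : Finset (MvPowerSeries (Fin n) K)}
    {f : MvPowerSeries (Fin n) K} :
    f ∈ Ideal.span (R : Set (MvPowerSeries (Fin n) K)) ↔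
      ∃ q : R → MvPowerSeries (Fin n) K, f = ∑ s : R, q s * (s : MvPowerSeries (Fin n) K) := by
  rw [Ideal.span, Submodule.mem_span_finset']
  simp only [smul_eq_mul, eq_comm]

/-! ### Division by a finite set of power series -/

/-- The hypothesis is put on the monomials of `q` rather than on `leadMon ord q`, so that `q = 0`
needs no separate treatment. -/
theorem mul_mem_above_of_coeff {ord : MonomialOrder (Fin n)} {L : ord.syn}
    {q s : MvPowerSeries (Fin n) K}
    (h : ∀ a, coeff a q ≠ 0 → L ≤ ord.toSyn (a + leadMon ord s)) : q * s ∈ above K ord L := by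
  classical
  intro b hb
  rw [coeff_mul]
  refine Finset.sum_eq_zero fun p hp => ?_
  rw [Finset.HasAntidiagonal.mem_antidiagonal] at hp
  by_contra hne
  have h1 := h _ (left_ne_zero_of_mul hne)
  have h2 := leadMon_le ord (right_ne_zero_of_mul hne)
  rw [← hp, map_add] at hb
  rw [map_add] at h1
  exact (h1.trans (add_le_add_right h2 _)).not_gt hb

/-- For every reducible monomial `M`, a multiple `∑ p M s * s` of an element of `R` with leading
monomial `M` and leading coefficient `1`. -/
theorem exists_multipliers (ord : MonomialOrder (Fin n)) (R : Finset (MvPowerSeries (Fin n) K))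
    (hR : ∀ s ∈ R, s ≠ 0) :
    ∃ p : (Fin n →₀ ℕ) → R → MvPowerSeries (Fin n) K,
      (∀ M s a, coeff a (p M s) ≠ 0 → M = a + leadMon ord (s : MvPowerSeries (Fin n) K)) ∧
      (∀ M, ¬ Reducible ord (R : Set (MvPowerSeries (Fin n) K)) M → ∀ s, p M s = 0) ∧
      ∀ M, Reducible ord (R : Set (MvPowerSeries (Fin n) K)) M →
        coeff M (∑ s : R, p M s * (s : MvPowerSeries (Fin n) K)) = 1 ∧
        ∀ f, coeff M f ≠ 0 → Reduces ord (R : Set (MvPowerSeries (Fin n) K)) f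
          (f - coeff M f • ∑ s : R, p M s * (s : MvPowerSeries (Fin n) K)) := by
  classical
  have hsel : ∀ M, Reducible ord (R : Set (MvPowerSeries (Fin n) K)) M →
      ∃ t : R, ∃ a : Fin n →₀ ℕ, M = a + leadMon ord (t : MvPowerSeries (Fin n) K) :=
    fun M ⟨s, hs, a, ha⟩ => ⟨⟨s, hs⟩, a, ha⟩
  choose sel quo hM using hsel
  refine ⟨fun M s => if h : Reducible ord (R : Set (MvPowerSeries (Fin n) K)) M then
    if s = sel M h then monomial (quo M h) (leadCoeff ord (s : MvPowerSeries (Fin n) K))⁻¹ else 0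
    else 0, fun M s a ha => ?_, fun M h s => dif_neg h, fun M h => ?_⟩
  · dsimp only at ha
    split_ifs at ha with h hs
    · by_cases haq : a = quo M h
      · rw [haq, hs]; exact hM M h
      · exact absurd (coeff_monomial_ne haq _) ha
    · exact absurd (map_zero _) ha
    · exact absurd (map_zero _) ha
  · have hsum : ∑ s : R, (if h : Reducible ord (R : Set (MvPowerSeries (Fin n) K)) M then
        if s = sel M h then monomial (quo M h) (leadCoeff ord (s : MvPowerSeries (Fin n) K))⁻¹
        else 0 else 0) * (s : MvPowerSeries (Fin n) K) =
        monomial (quo M h) (leadCoeff ord (sel M h : MvPowerSeries (Fin n) K))⁻¹ * (sel M h) := by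
      rw [Finset.sum_eq_single (sel M h)]
      · rw [dif_pos h, if_pos rfl]
      · intro b _ hb
        rw [dif_pos h, if_neg hb, zero_mul]
      · exact fun h' => absurd (Finset.mem_univ _) h'
    have hlc : leadCoeff ord (sel M h : MvPowerSeries (Fin n) K) ≠ 0 :=
      coeff_leadMon_ne_zero ord (hR _ (sel M h).2)
    rw [hsum]
    refine ⟨?_, fun f hf => ⟨M, hf, sel M h, (sel M h).2, quo M h, hM M h, ?_⟩⟩
    · have hco := coeff_add_monomial_mul (quo M h)
        (leadMon ord (sel M h : MvPowerSeries (Fin n) K)) (sel M h)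
        (leadCoeff ord (sel M h : MvPowerSeries (Fin n) K))⁻¹
      rw [← hM M h] at hco
      rw [hco]
      exact inv_mul_cancel₀ hlc
    · rw [div_eq_mul_inv, mul_smul, ← smul_mul_assoc _ (monomial (quo M h) (1 : K)), ← map_smul,
        smul_eq_mul, mul_one]

/-- The infinite sum of the multipliers needs no convergence argument: by `hp`, the monomial `a` of
the quotient by `s` receives a contribution only from `M = a · LM(s)`. What the first `k` terms miss
therefore sits at `a · LM(s) ≥ e k`. -/
theorem exists_quotients {ord : MonomialOrder (Fin n)} (e : ℕ ≃o ord.syn)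
    {R : Finset (MvPowerSeries (Fin n) K)}
    {p : (Fin n →₀ ℕ) → R → MvPowerSeries (Fin n) K}
    (hp : ∀ M s a, coeff a (p M s) ≠ 0 → M = a + leadMon ord (s : MvPowerSeries (Fin n) K))
    (c : (Fin n →₀ ℕ) → K) :
    ∃ q : R → MvPowerSeries (Fin n) K,
      (∀ s a, coeff a (q s) ≠ 0 → c (a + leadMon ord (s : MvPowerSeries (Fin n) K)) ≠ 0) ∧
      ∀ k, ∑ s : R, q s * (s : MvPowerSeries (Fin n) K) -
        ∑ j ∈ Finset.range k, c (ord.toSyn.symm (e j)) •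
          ∑ s : R, p (ord.toSyn.symm (e j)) s * (s : MvPowerSeries (Fin n) K) ∈
            above K ord (e k) := by
  let q : R → MvPowerSeries (Fin n) K := fun s a =>
    c (a + leadMon ord (s : MvPowerSeries (Fin n) K)) *
      coeff a (p (a + leadMon ord (s : MvPowerSeries (Fin n) K)) s)
  have hq : ∀ s a, coeff a (q s) = c (a + leadMon ord (s : MvPowerSeries (Fin n) K)) *
      coeff a (p (a + leadMon ord (s : MvPowerSeries (Fin n) K)) s) := fun _ _ => rfl
  refine ⟨q, fun s a h => left_ne_zero_of_mul h, fun k => ?_⟩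
  have hrw : ∑ s : R, q s * (s : MvPowerSeries (Fin n) K) -
        ∑ j ∈ Finset.range k, c (ord.toSyn.symm (e j)) •
          ∑ s : R, p (ord.toSyn.symm (e j)) s * (s : MvPowerSeries (Fin n) K) =
      ∑ s : R, (q s - ∑ j ∈ Finset.range k, c (ord.toSyn.symm (e j)) •
        p (ord.toSyn.symm (e j)) s) * (s : MvPowerSeries (Fin n) K) := by
    simp only [Finset.smul_sum, sub_mul, Finset.sum_mul, Finset.sum_sub_distrib, smul_mul_assoc]
    rw [Finset.sum_comm]
  rw [hrw]
  refine sum_mem fun s _ => mul_mem_above_of_coeff fun a ha => ?_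
  by_contra hlt
  rw [not_le] at hlt
  apply ha
  obtain ⟨i, hi⟩ := e.surjective (ord.toSyn (a + leadMon ord (s : MvPowerSeries (Fin n) K)))
  have hi' : ord.toSyn.symm (e i) = a + leadMon ord (s : MvPowerSeries (Fin n) K) := by
    rw [hi, AddEquiv.symm_apply_apply]
  rw [← hi, e.lt_iff_lt] at hlt
  -- The one index that contributes, `i`, already lies below `k`, so the partial sum has the full
  -- coefficient.
  rw [map_sub, map_sum, Finset.sum_eq_single i, coeff_smul, hi', hq, sub_self]
  · intro j _ hj
    rw [coeff_smul]
    by_contra hne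
    have h1 := hp _ s a (right_ne_zero_of_mul hne)
    rw [← hi'] at h1
    exact hj (e.injective (ord.toSyn.symm.injective h1))
  · exact fun h => absurd (Finset.mem_range.mpr hlt) h

/-- One sweep through the monomials suffices, since cancelling a monomial alters only it and larger
ones. -/
theorem exists_chainRew_normalForm (hn : 0 < n) {ord : MonomialOrder (Fin n)}
    (hord : DegreeCompatible ord) {R : Finset (MvPowerSeries (Fin n) K)} (hR : ∀ s ∈ R, s ≠ 0)
    (f : MvPowerSeries (Fin n) K) :
    ∃ α ∈ (system ord (R : Set (MvPowerSeries (Fin n) K))).NormalForms,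
      (system ord (R : Set (MvPowerSeries (Fin n) K))).ChainRew f α ∧
      ∃ q : R → MvPowerSeries (Fin n) K,
        f = α + ∑ s : R, q s * (s : MvPowerSeries (Fin n) K) ∧
        ∀ s a, coeff a (q s) ≠ 0 →
          ord.toSyn (leadMon ord f) ≤
            ord.toSyn (a + leadMon ord (s : MvPowerSeries (Fin n) K)) := by
  obtain ⟨e⟩ := exists_orderIso_nat hn hord
  obtain ⟨p, hp, hp0, hp1⟩ := exists_multipliers ord R hR
  let m : ℕ → (Fin n →₀ ℕ) := fun k => ord.toSyn.symm (e k)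
  have hm : ∀ k, ord.toSyn (m k) = e k := fun k => ord.toSyn.apply_symm_apply _
  let r : (Fin n →₀ ℕ) → MvPowerSeries (Fin n) K :=
    fun M => ∑ s : R, p M s * (s : MvPowerSeries (Fin n) K)
  have hr : ∀ M, r M ∈ above K ord (ord.toSyn M) := fun M =>
    sum_mem fun s _ => mul_mem_above_of_coeff fun a ha => by rw [hp M s a ha]
  -- When `m k` is irreducible, `r (m k) = 0` and the chain pauses.
  let h : ℕ → MvPowerSeries (Fin n) K :=
    Nat.rec f fun k g => g - coeff (m k) g • r (m k)
  have hsucc : ∀ k, h (k + 1) = h k - coeff (m k) (h k) • r (m k) := fun _ => rfl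
  -- The coefficient of `M` at the moment when the sweep reaches `M`.
  let c : (Fin n →₀ ℕ) → K := fun M => coeff M (h (e.symm (ord.toSyn M)))
  have hc : ∀ k, c (m k) = coeff (m k) (h k) := fun k => by simp [c, m]
  obtain ⟨q, hq, hlim⟩ := exists_quotients e hp c
  have hsum : ∀ k, f - h k = ∑ j ∈ Finset.range k, c (m j) • r (m j) := by
    intro k
    induction k with
    | zero => simp [h]
    | succ k ih => rw [Finset.sum_range_succ, ← ih, hsucc, hc]; abel
  set α := f - ∑ s : R, q s * (s : MvPowerSeries (Fin n) K) with hα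
  have hlim' : ∀ k, h k - α ∈ above K ord (e k) := fun k => by
    have h1 : h k - α = ∑ s : R, q s * (s : MvPowerSeries (Fin n) K) - (f - h k) := by
      rw [hα]; abel
    rw [h1, hsum]
    exact hlim k
  have habove : ∀ k, h k ∈ above K ord (ord.toSyn (leadMon ord f)) := by
    intro k
    induction k with
    | zero => exact mem_above_leadMon ord f
    | succ k ih =>
      rw [hsucc]
      by_cases h0 : coeff (m k) (h k) = 0
      · rwa [h0, zero_smul, sub_zero]
      · refine sub_mem ih (Submodule.smul_mem _ _ (above_antitone ?_ (hr (m k))))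
        by_contra hlt
        exact h0 (ih _ (not_le.mp hlt))
  refine ⟨α, mem_normalForms_iff.mpr fun M hM => ?_, ⟨h, rfl, fun k => ?_, ?_⟩, q, ?_, ?_⟩
  · obtain ⟨k, hk⟩ := e.surjective (ord.toSyn M)
    obtain rfl : m k = M := ord.toSyn.injective ((hm k).trans hk)
    -- The limit agrees at `m k` with `h (k + 1)`, where that monomial has just been cancelled.
    have h1 := hlim' (k + 1) (m k) (by rw [hm, e.lt_iff_lt]; exact Nat.lt_succ_self k)
    rw [map_sub, hsucc, map_sub, coeff_smul, (hp1 _ hM).1, mul_one, sub_self, zero_sub,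
      neg_eq_zero] at h1
    exact h1
  · by_cases hred : Reducible ord (R : Set (MvPowerSeries (Fin n) K)) (m k)
    · by_cases h0 : coeff (m k) (h k) = 0
      · left; rw [hsucc, h0, zero_smul, sub_zero]
      · exact Or.inr ((hp1 _ hred).2 _ h0)
    · left
      have h1 : r (m k) = 0 := Finset.sum_eq_zero fun s _ => by rw [hp0 _ hred, zero_mul]
      rw [hsucc, h1, smul_zero, sub_zero]
  · refine (nhds_deltaTopology_hasBasis α).tendsto_right_iff.mpr fun N _ => ?_
    filter_upwards [Filter.eventually_ge_atTop (e.symm (ord.toSyn (Finsupp.single ⟨0, hn⟩ N)))]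
      with k hk
    exact above_le_orderGE hn hord N (above_antitone (e.symm_apply_le.mp hk) (hlim' k))
  · rw [hα, sub_add_cancel]
  · intro s a ha
    by_contra hlt
    exact hq s a ha (habove _ _ (not_le.mp hlt))

/-! ### Finitary confluence makes the elements of the ideal reducible -/

/-- The span of the monomial multiples of elements of `R` with leading monomial at least `L`. -/
def multiplesAbove (ord : MonomialOrder (Fin n)) (R : Set (MvPowerSeries (Fin n) K))
    (L : ord.syn) : Submodule K (MvPowerSeries (Fin n) K) :=
  Submodule.span K {g | ∃ s ∈ R, ∃ a : Fin n →₀ ℕ,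
    L ≤ ord.toSyn (a + leadMon ord s) ∧ g = monomial a (1 : K) * s}

theorem multiplesAbove_le_above (ord : MonomialOrder (Fin n))
    (R : Set (MvPowerSeries (Fin n) K)) (L : ord.syn) :
    multiplesAbove ord R L ≤ above K ord L := by
  refine Submodule.span_le.mpr ?_
  rintro _ ⟨s, -, a, h, rfl⟩
  exact above_antitone h (monomial_mul_mem_above ord a 1 s)

/-- Every reduct stays in `above K ord L`, so each monomial eliminated, hence each multiple
subtracted, is at level `L` or higher. -/
theorem sub_mem_multiplesAbove_of_finRew {ord : MonomialOrder (Fin n)}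
    {R : Set (MvPowerSeries (Fin n) K)} {L : ord.syn} {f g : MvPowerSeries (Fin n) K}
    (hf : f ∈ above K ord L) (h : (system ord R).FinRew f g) :
    f - g ∈ multiplesAbove ord R L := by
  induction h with
  | refl => rw [sub_self]; exact zero_mem _
  | @tail b _ _ hs ih =>
    obtain ⟨M, hM, s, hs, a, rfl, rfl⟩ := hs
    have hb : b ∈ above K ord L := by
      rw [← sub_sub_cancel f b]
      exact sub_mem hf (multiplesAbove_le_above ord R L ih)
    rw [← sub_add]
    refine add_mem ih (Submodule.smul_mem _ _ (Submodule.subset_span ⟨s, hs, a, ?_, rfl⟩))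
    by_contra hlt
    exact hM (hb _ (not_le.mp hlt))

theorem exists_polynomial_sub_mem_orderGE (f : MvPowerSeries (Fin n) K) (N : ℕ) :
    ∃ P ∈ Submodule.span K (Set.range fun a : Fin n →₀ ℕ => monomial a (1 : K)),
      f - P ∈ orderGE K n N := by
  classical
  let D := (Finsupp.finite_of_degree_le (σ := Fin n) N).toFinset
  refine ⟨∑ a ∈ D, coeff a f • monomial a (1 : K), sum_mem fun a _ =>
    Submodule.smul_mem _ _ (Submodule.subset_span ⟨a, rfl⟩), fun b hb => ?_⟩
  rw [map_sub, map_sum, Finset.sum_eq_single b, coeff_smul, coeff_monomial_same, mul_one, sub_self]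
  · intro a _ hab
    rw [coeff_smul, coeff_monomial_ne hab.symm, mul_zero]
  · intro h
    exact absurd ((Set.Finite.mem_toFinset (Finsupp.finite_of_degree_le N)).mpr hb.le) h

theorem mul_mem_orderGE {N : ℕ} {f : MvPowerSeries (Fin n) K} (hf : f ∈ orderGE K n N)
    (g : MvPowerSeries (Fin n) K) : f * g ∈ orderGE K n N := fun a ha => by
  classical
  rw [coeff_mul]
  refine Finset.sum_eq_zero fun p hp => ?_
  rw [Finset.HasAntidiagonal.mem_antidiagonal] at hp
  rw [hf p.1 (lt_of_le_of_lt ?_ ha), zero_mul]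
  rw [← hp, map_add]
  exact Nat.le_add_right _ _

/-- `multiplesAbove` is only a `K`-span, so power series coefficients are truncated to polynomials
and `orderGE` absorbs the tails. -/
theorem mem_multiplesAbove_sup_of_mem_span {ord : MonomialOrder (Fin n)}
    {R : Set (MvPowerSeries (Fin n) K)} {L : ord.syn} (hL : ∀ x, L ≤ x) (N : ℕ)
    {f : MvPowerSeries (Fin n) K} (hf : f ∈ Ideal.span R) :
    f ∈ multiplesAbove ord R L ⊔ orderGE K n N := by
  refine Submodule.closure_induction
    (p := fun f _ => f ∈ multiplesAbove ord R L ⊔ orderGE K n N) (zero_mem _)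
    (fun _ _ _ _ => add_mem) (fun r s hs => ?_) hf
  obtain ⟨P, hP, hrP⟩ := exists_polynomial_sub_mem_orderGE r N
  rw [smul_eq_mul, ← add_sub_cancel P r, add_mul]
  refine add_mem (Submodule.mem_sup_left ?_) (Submodule.mem_sup_right (mul_mem_orderGE hrP s))
  refine Submodule.span_induction (p := fun P _ => P * s ∈ multiplesAbove ord R L)
    ?_ ?_ ?_ ?_ hP
  · rintro _ ⟨a, rfl⟩
    exact Submodule.subset_span ⟨s, hs, a, hL _, rfl⟩
  · rw [zero_mul]; exact zero_mem _
  · intro x y _ _ hx hy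
    rw [add_mul]
    exact add_mem hx hy
  · intro c x _ hx
    rw [smul_mul_assoc]
    exact Submodule.smul_mem _ c hx

/-- The inductive step of Buchberger's argument. Generators with leading monomial exactly `M` are
replaced, by confluence, with scalar multiples of a fixed one; their total coefficient is that of
`M`, hence zero. -/
theorem mem_multiplesAbove_succ_sup {ord : MonomialOrder (Fin n)} (e : ℕ ≃o ord.syn)
    {R : Set (MvPowerSeries (Fin n) K)} (hR : ∀ s ∈ R, s ≠ 0)
    (hconf : (system ord R).FinitaryTopConfluent) {N k : ℕ} {M : Fin n →₀ ℕ}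
    (hM : ord.toSyn M = e k) (hN : M.degree < N) {f : MvPowerSeries (Fin n) K}
    (hf : f ∈ multiplesAbove ord R (e k) ⊔ orderGE K n N)
    (h : ¬ Reducible ord R M ∨ coeff M f = 0) :
    f ∈ multiplesAbove ord R (e (k + 1)) ⊔ orderGE K n N := by
  set W := multiplesAbove ord R (e (k + 1)) ⊔ orderGE K n N
  have hgt : ∀ s ∈ R, ∀ a : Fin n →₀ ℕ, M ≠ a + leadMon ord s →
      e k ≤ ord.toSyn (a + leadMon ord s) → monomial a (1 : K) * s ∈ W := by
    intro s hs a hne hle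
    refine Submodule.mem_sup_left (Submodule.subset_span ⟨s, hs, a, ?_, rfl⟩)
    rw [apply_add_one_le_iff]
    refine lt_of_le_of_ne hle fun heq => hne (ord.toSyn.injective (hM.trans heq))
  have hWe : ∀ g ∈ multiplesAbove ord R (e k), ¬ Reducible ord R M → g ∈ W := by
    intro g hg hred
    refine Submodule.span_le.mpr ?_ hg
    rintro _ ⟨s, hs, a, hle, rfl⟩
    exact hgt s hs a (fun heq => hred ⟨s, hs, a, heq⟩) hle
  obtain ⟨g, hg, t, ht, rfl⟩ := Submodule.mem_sup.mp hf
  refine add_mem ?_ (Submodule.mem_sup_right ht)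
  by_cases hred : Reducible ord R M
  swap
  · exact hWe g hg hred
  -- Since `M.degree < N`, the part of order at least `N` does not affect the coefficient of `M`.
  have hg0 : coeff M g = 0 := by
    have h0 := h.resolve_left (not_not_intro hred)
    rwa [map_add, ht M hN, add_zero] at h0
  clear h hf
  obtain ⟨s₀, hs₀, a₀, ha₀⟩ := hred
  have habove : ∀ s ∈ R, ∀ a : Fin n →₀ ℕ, M = a + leadMon ord s →
      monomial M (1 : K) - (1 / leadCoeff ord s) • (monomial a (1 : K) * s) ∈
        above K ord (e (k + 1)) := by
    intro s hs a ha b hb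
    have hlc : leadCoeff ord s ≠ 0 := coeff_leadMon_ne_zero ord (hR s hs)
    have hble : ord.toSyn b ≤ ord.toSyn M := by
      rw [hM, ← not_lt, ← apply_add_one_le_iff]
      exact hb.not_ge
    rcases hble.eq_or_lt with heq | hlt
    · obtain rfl := ord.toSyn.injective heq
      rw [map_sub, coeff_smul, coeff_monomial_same]
      conv_lhs => rw [ha]
      rw [coeff_add_monomial_mul, one_mul]
      change 1 - 1 / leadCoeff ord s * leadCoeff ord s = 0
      rw [one_div_mul_cancel hlc, sub_self]
    · have h1 := monomial_mul_mem_above ord a (1 : K) s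
      rw [← ha] at h1
      exact sub_mem (monomial_mem_above ord M 1) (Submodule.smul_mem _ _ h1) b hlt
  have hstep : ∀ s ∈ R, ∀ a : Fin n →₀ ℕ, M = a + leadMon ord s →
      (system ord R).FinRew (monomial M (1 : K))
        (monomial M (1 : K) - (1 / leadCoeff ord s) • (monomial a (1 : K) * s)) := by
    intro s hs a ha
    refine Relation.ReflTransGen.single ⟨M, ?_, s, hs, a, ha, ?_⟩
    · rw [coeff_monomial_same]; exact one_ne_zero
    · rw [coeff_monomial_same]
  -- The two one-step reducts of the monomial `M` rewrite to series agreeing up to order `N`, and by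
  -- `habove` those rewrites use only multiples above `M`.
  have hdiff : ∀ s ∈ R, ∀ a : Fin n →₀ ℕ, M = a + leadMon ord s →
      (1 / leadCoeff ord s) • (monomial a (1 : K) * s) -
        (1 / leadCoeff ord s₀) • (monomial a₀ (1 : K) * s₀) ∈ W := by
    intro s hs a ha
    obtain ⟨d, hd₀, hd⟩ := hconf _ _ _ (hstep s₀ hs₀ a₀ ha₀) (hstep s hs a ha)
    obtain ⟨d₀', hf₀, ho₀⟩ := topRew_system_iff.mp hd₀ N
    obtain ⟨d', hf', ho'⟩ := topRew_system_iff.mp hd N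
    have h₀ := sub_mem_multiplesAbove_of_finRew (habove s₀ hs₀ a₀ ha₀) hf₀
    have h' := sub_mem_multiplesAbove_of_finRew (habove s hs a ha) hf'
    have := add_mem (Submodule.mem_sup_left (T := orderGE K n N) (sub_mem h₀ h'))
      (Submodule.mem_sup_right (S := multiplesAbove ord R (e (k + 1))) (sub_mem ho₀ ho'))
    convert this using 1
    abel
  -- Subtracting `coeff M g` times the fixed normalized multiple makes the claim linear in `g`, so
  -- generators suffice.
  have key : ∀ g ∈ multiplesAbove ord R (e k),
      g - coeff M g • ((1 / leadCoeff ord s₀) • (monomial a₀ (1 : K) * s₀)) ∈ W := by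
    intro g hg
    refine Submodule.span_induction (p := fun g _ => g - coeff M g •
      ((1 / leadCoeff ord s₀) • (monomial a₀ (1 : K) * s₀)) ∈ W) ?_ ?_ ?_ ?_ hg
    · rintro _ ⟨s, hs, a, hle, rfl⟩
      by_cases hMa : M = a + leadMon ord s
      · have hlc : leadCoeff ord s ≠ 0 := coeff_leadMon_ne_zero ord (hR s hs)
        have hcoe : coeff M (monomial a (1 : K) * s) = leadCoeff ord s := by
          conv_lhs => rw [hMa]
          rw [coeff_add_monomial_mul, one_mul]
          rfl
        have := Submodule.smul_mem W (leadCoeff ord s) (hdiff s hs a hMa)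
        rwa [smul_sub, smul_smul, mul_one_div_cancel hlc, one_smul, ← hcoe] at this
      · rw [monomial_mul_mem_above ord a (1 : K) s M, zero_smul, sub_zero]
        · exact hgt s hs a hMa hle
        · rw [hM]
          exact lt_of_le_of_ne hle fun heq => hMa (ord.toSyn.injective (hM.trans heq))
    · rw [map_zero, zero_smul, sub_zero]; exact zero_mem _
    · intro x y _ _ hx hy
      rw [map_add, add_smul, add_sub_add_comm]
      exact add_mem hx hy
    · intro c x _ hx
      rw [coeff_smul, mul_smul, ← smul_sub]
      exact Submodule.smul_mem _ _ hx
  have := key g hg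
  rwa [hg0, zero_smul, sub_zero] at this

theorem exists_reducible_of_finitaryTopConfluent (hn : 0 < n) {ord : MonomialOrder (Fin n)}
    (hord : DegreeCompatible ord) {R : Set (MvPowerSeries (Fin n) K)} (hR : ∀ s ∈ R, s ≠ 0)
    (hconf : (system ord R).FinitaryTopConfluent) {f : MvPowerSeries (Fin n) K}
    (hf : f ∈ Ideal.span R) (hf0 : f ≠ 0) : Reducible ord R (leadMon ord f) := by
  obtain ⟨e⟩ := exists_orderIso_nat hn hord
  by_contra hred
  obtain ⟨k, hk⟩ := e.surjective (ord.toSyn (leadMon ord f))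
  -- The least precision at which the coefficient of `LM(f)` is still seen.
  set N := (leadMon ord f).degree + 1
  have hW : ∀ j ≤ k + 1, f ∈ multiplesAbove ord R (e j) ⊔ orderGE K n N := by
    intro j hj
    induction j with
    | zero =>
      refine mem_multiplesAbove_sup_of_mem_span (fun x => ?_) N hf
      obtain ⟨i, rfl⟩ := e.surjective x
      exact e.monotone (Nat.zero_le i)
    | succ j ih =>
      have hle : ord.toSyn (ord.toSyn.symm (e j)) ≤ ord.toSyn (leadMon ord f) := by
        rw [AddEquiv.apply_symm_apply, ← hk]
        exact e.monotone (Nat.le_of_succ_le_succ hj)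
      refine mem_multiplesAbove_succ_sup e hR hconf (M := ord.toSyn.symm (e j))
        (AddEquiv.apply_symm_apply _ _)
        (Nat.lt_succ_of_le (degree_le_of_toSyn_le hord hle)) (ih (Nat.le_of_succ_le hj)) ?_
      rcases hle.eq_or_lt with heq | hlt
      · left
        rwa [ord.toSyn.injective heq]
      · exact Or.inr (mem_above_leadMon ord f _ hlt)
  obtain ⟨g, hg, t, ht, hgt⟩ := Submodule.mem_sup.mp (hW (k + 1) le_rfl)
  apply coeff_leadMon_ne_zero ord hf0
  have hfg : coeff (leadMon ord f) f = coeff (leadMon ord f) (g + t) := by rw [hgt]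
  rw [hfg, map_add, ht _ (Nat.lt_succ_self _), add_zero]
  refine multiplesAbove_le_above ord R _ hg _ ?_
  rw [← hk, e.lt_iff_lt]
  exact Nat.lt_succ_self k

/-! ### Consequences of reducibility of the elements of the ideal -/

/-- If every nonzero element of the ideal has a reducible leading monomial, then two normal forms
that are congruent up to arbitrarily high order are equal. -/
theorem eq_of_mem_normalForms {ord : MonomialOrder (Fin n)} (hord : DegreeCompatible ord)
    {R : Set (MvPowerSeries (Fin n) K)}
    (hred : ∀ f ∈ Ideal.span R, f ≠ 0 → Reducible ord R (leadMon ord f))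
    {α β : MvPowerSeries (Fin n) K} (hα : α ∈ (system ord R).NormalForms)
    (hβ : β ∈ (system ord R).NormalForms)
    (h : ∀ N, ∃ g ∈ Ideal.span R, α - β - g ∈ orderGE K n N) : α = β := by
  by_contra hne
  set d := α - β
  have hd : d ≠ 0 := sub_ne_zero.mpr hne
  -- At this precision `g` agrees with `d` up to and including `LM(d)`, so the two leading monomials
  -- coincide.
  obtain ⟨g, hg, hgd⟩ := h ((leadMon ord d).degree + 1)
  have hcoe : ∀ b : Fin n →₀ ℕ, ord.toSyn b ≤ ord.toSyn (leadMon ord d) →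
      coeff b g = coeff b d := fun b hb => by
    have := hgd b (Nat.lt_succ_of_le (degree_le_of_toSyn_le hord hb))
    rw [map_sub, sub_eq_zero] at this
    exact this.symm
  have hgl : coeff (leadMon ord d) g ≠ 0 := by
    rw [hcoe _ le_rfl]; exact coeff_leadMon_ne_zero ord hd
  have hg0 : g ≠ 0 := fun h0 => hgl (by rw [h0, map_zero])
  have hlm : leadMon ord g = leadMon ord d := by
    have hle := leadMon_le ord hgl
    refine ord.toSyn.injective (le_antisymm hle (leadMon_le ord ?_))
    rw [← hcoe _ hle]
    exact coeff_leadMon_ne_zero ord hg0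
  have hr := hred g hg hg0
  rw [hlm] at hr
  apply coeff_leadMon_ne_zero ord hd
  rw [map_sub, mem_normalForms_iff.mp hα _ hr, mem_normalForms_iff.mp hβ _ hr, sub_zero]

/-- Finite rewrites stay in a class modulo the ideal; for their limits only this approximate
congruence is claimed, and it is all that `eq_of_mem_normalForms` needs. -/
theorem exists_mem_span_of_topRew {ord : MonomialOrder (Fin n)}
    {R : Set (MvPowerSeries (Fin n) K)} {f g : MvPowerSeries (Fin n) K}
    (h : (system ord R).TopRew f g) (N : ℕ) :
    ∃ t ∈ Ideal.span R, f - g - t ∈ orderGE K n N := by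
  obtain ⟨g', h1, h2⟩ := topRew_system_iff.mp h N
  refine ⟨f - g', sub_mem_span_of_finRew h1, ?_⟩
  rwa [sub_sub_sub_cancel_left]

/-- The remainder of the division is a normal form in the ideal, hence zero, and the quotients
already satisfy the lower bound. -/
theorem hasStandardRep_of_mem_span (hn : 0 < n) {ord : MonomialOrder (Fin n)}
    (hord : DegreeCompatible ord) {R : Finset (MvPowerSeries (Fin n) K)} (hR : ∀ s ∈ R, s ≠ 0)
    (hNF : ∀ f ∈ Ideal.span (R : Set (MvPowerSeries (Fin n) K)), f ≠ 0 →
      f ∉ (system ord (R : Set (MvPowerSeries (Fin n) K))).NormalForms)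
    {f : MvPowerSeries (Fin n) K} (hf : f ∈ Ideal.span (R : Set (MvPowerSeries (Fin n) K)))
    (hf0 : f ≠ 0) : HasStandardRep ord R f := by
  obtain ⟨α, hα, -, q, hq, hle⟩ := exists_chainRew_normalForm hn hord hR f
  have hα0 : α = 0 := by
    by_contra hne
    refine hNF α ?_ hne hα
    rw [eq_sub_of_add_eq hq.symm]
    exact sub_mem hf (mem_span_iff_exists_sum.mpr ⟨q, rfl⟩)
  rw [hα0, zero_add] at hq
  have hlow : ∀ s : R, q s ≠ 0 → ord.toSyn (leadMon ord f) ≤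
      ord.toSyn (leadMon ord (q s * (s : MvPowerSeries (Fin n) K))) := fun s hs => by
    rw [leadMon_mul ord hs (hR s s.2)]
    exact hle s _ (coeff_leadMon_ne_zero ord hs)
  refine ⟨q, hq, ?_, ?_⟩
  -- The bound is attained: some product must contribute to the coefficient of `LM(f)`.
  · have hsum : coeff (leadMon ord f) (∑ s : R, q s * (s : MvPowerSeries (Fin n) K)) ≠ 0 := by
      rw [← hq]; exact coeff_leadMon_ne_zero ord hf0
    rw [map_sum] at hsum
    obtain ⟨s, -, hs⟩ := Finset.exists_ne_zero_of_sum_ne_zero hsum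
    have hqs : q s ≠ 0 := fun h0 => hs (by rw [h0, zero_mul, map_zero])
    exact ⟨s, hqs, le_antisymm (hlow s hqs) (leadMon_le ord hs)⟩
  · rintro _ ⟨s, hs, rfl⟩
    exact hlow s hs

end StdBasis

/-! ### The equivalences -/

theorem mainTheorem1 {K : Type*} [Field K] {n : ℕ} (hn : 0 < n)
    (ord : MonomialOrder (Fin n)) (hord : StdBasis.DegreeCompatible ord)
    (R : Finset (MvPowerSeries (Fin n) K)) (hR : ∀ s ∈ R, s ≠ 0) :
    List.TFAE [
      (StdBasis.system ord (R : Set (MvPowerSeries (Fin n) K))).FinitaryTopConfluent,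
      ∀ f ∈ Ideal.span (R : Set (MvPowerSeries (Fin n) K)),
        (StdBasis.system ord (R : Set (MvPowerSeries (Fin n) K))).TopRew f 0,
      ∀ f ∈ Ideal.span (R : Set (MvPowerSeries (Fin n) K)), f ≠ 0 →
        f ∉ (StdBasis.system ord (R : Set (MvPowerSeries (Fin n) K))).NormalForms,
      StdBasis.IsStandardBasis ord (R : Set (MvPowerSeries (Fin n) K))
        (Ideal.span (R : Set (MvPowerSeries (Fin n) K))),
      ∀ f ∈ Ideal.span (R : Set (MvPowerSeries (Fin n) K)),
        (StdBasis.system ord (R : Set (MvPowerSeries (Fin n) K))).ChainRew f 0,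
      ∀ f ∈ Ideal.span (R : Set (MvPowerSeries (Fin n) K)), f ≠ 0 →
        StdBasis.HasStandardRep ord R f,
      ∀ f : MvPowerSeries (Fin n) K, ∃! α : MvPowerSeries (Fin n) K,
        α ∈ (StdBasis.system ord (R : Set (MvPowerSeries (Fin n) K))).NormalForms ∧
          ∃ q : R → MvPowerSeries (Fin n) K,
            f = α + ∑ s : R, q s * (s : MvPowerSeries (Fin n) K),
      Function.Bijective
        (fun α : (StdBasis.system ord (R : Set (MvPowerSeries (Fin n) K))).NormalForms =>
          Ideal.Quotient.mk (Ideal.span (R : Set (MvPowerSeries (Fin n) K)))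
            (α : MvPowerSeries (Fin n) K)),
      (StdBasis.system ord (R : Set (MvPowerSeries (Fin n) K))).InfinitaryTopConfluent] := by
  open StdBasis in
  have hred_iff : (∀ f ∈ Ideal.span (R : Set (MvPowerSeries (Fin n) K)), f ≠ 0 →
      Reducible ord (R : Set (MvPowerSeries (Fin n) K)) (leadMon ord f)) ↔
      IsStandardBasis ord (R : Set (MvPowerSeries (Fin n) K))
        (Ideal.span (R : Set (MvPowerSeries (Fin n) K))) :=
    ⟨fun h => ⟨fun s hs => ⟨Ideal.subset_span hs, hR s hs⟩, h⟩, fun h => h.2⟩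
  open StdBasis in
  have h0NF : (0 : MvPowerSeries (Fin n) K) ∈
      (system ord (R : Set (MvPowerSeries (Fin n) K))).NormalForms :=
    mem_normalForms_iff.mpr fun M _ => map_zero _
  tfae_have 1 → 4 := fun h => hred_iff.mp fun f hf hf0 =>
    StdBasis.exists_reducible_of_finitaryTopConfluent hn hord hR h hf hf0
  tfae_have 4 → 3 := fun h f hf hf0 hNF =>
    StdBasis.coeff_leadMon_ne_zero ord hf0
      (StdBasis.mem_normalForms_iff.mp hNF _ (h.2 f hf hf0))
  tfae_have 3 → 6 := fun h f hf hf0 => StdBasis.hasStandardRep_of_mem_span hn hord hR h hf hf0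
  tfae_have 6 → 4 := by
    refine fun h => hred_iff.mp fun f hf hf0 => ?_
    obtain ⟨q, -, ⟨s, hqs, hs⟩, -⟩ := h f hf hf0
    rw [StdBasis.leadMon_mul ord hqs (hR s s.2)] at hs
    exact ⟨s, s.2, _, ord.toSyn.injective hs⟩
  tfae_have 3 → 5 := by
    intro h f hf
    obtain ⟨α, hα, hch, q, hq, -⟩ := StdBasis.exists_chainRew_normalForm hn hord hR f
    have hαI : α ∈ Ideal.span (R : Set (MvPowerSeries (Fin n) K)) := by
      rw [eq_sub_of_add_eq hq.symm]
      exact sub_mem hf (StdBasis.mem_span_iff_exists_sum.mpr ⟨q, rfl⟩)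
    obtain rfl : α = 0 := by
      by_contra hne
      exact h α hαI hne hα
    exact hch
  tfae_have 5 → 2 := fun h f hf => StdBasis.ChainRew.topRew (h f hf)
  tfae_have 2 → 3 := by
    intro h f hf hf0 hNF
    apply hf0
    ext a
    obtain ⟨g, hfg, hg⟩ := StdBasis.topRew_system_iff.mp (h f hf) (a.degree + 1)
    -- A normal form has no finite rewrite but itself, so it is as close to `0` as desired.
    rcases hfg.cases_head with rfl | ⟨b, hb, -⟩
    · simpa using hg a (Nat.lt_succ_self _)
    · exact absurd ⟨b, hb⟩ hNF
  tfae_have 4 → 7 := by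
    intro h f
    obtain ⟨α, hα, -, q, hq, -⟩ := StdBasis.exists_chainRew_normalForm hn hord hR f
    refine ⟨α, ⟨hα, q, hq⟩, ?_⟩
    rintro β ⟨hβ, q', hq'⟩
    refine StdBasis.eq_of_mem_normalForms hord h.2 hβ hα fun N => ⟨β - α, ?_, ?_⟩
    · rw [eq_sub_of_add_eq hq.symm, eq_sub_of_add_eq hq'.symm, sub_sub_sub_cancel_left]
      exact sub_mem (StdBasis.mem_span_iff_exists_sum.mpr ⟨q, rfl⟩)
        (StdBasis.mem_span_iff_exists_sum.mpr ⟨q', rfl⟩)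
    · rw [sub_self]; exact zero_mem _
  tfae_have 7 → 8 := by
    intro h
    constructor
    · rintro ⟨α, hα⟩ ⟨β, hβ⟩ hαβ
      obtain ⟨q, hq⟩ := StdBasis.mem_span_iff_exists_sum.mp (Ideal.Quotient.eq.mp hαβ)
      -- Uniqueness is applied to two decompositions of `α`: as `α + 0` and as `β + (α - β)`.
      exact Subtype.ext ((h α).unique ⟨hα, 0, by simp⟩ ⟨hβ, q, by rw [← hq]; simp⟩)
    · intro x
      obtain ⟨f, rfl⟩ := Ideal.Quotient.mk_surjective x
      obtain ⟨α, ⟨hα, q, hq⟩, -⟩ := h f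
      refine ⟨⟨α, hα⟩, Ideal.Quotient.eq.mpr ?_⟩
      rw [← neg_sub, neg_mem_iff]
      exact StdBasis.mem_span_iff_exists_sum.mpr ⟨q, by rw [hq]; simp⟩
  tfae_have 8 → 3 := by
    intro h f hf hf0 hNF
    refine hf0 (congrArg Subtype.val (h.1 (a₁ := ⟨f, hNF⟩) (a₂ := ⟨0, h0NF⟩) ?_))
    exact Ideal.Quotient.eq.mpr (by simpa using hf)
  tfae_have 4 → 9 := by
    intro h a b c hab hac
    obtain ⟨β, hβ, hbβ, q, hq, -⟩ := StdBasis.exists_chainRew_normalForm hn hord hR b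
    obtain ⟨γ, hγ, hcγ, q', hq', -⟩ := StdBasis.exists_chainRew_normalForm hn hord hR c
    -- Both normal forms are congruent to `a` up to every order.
    have hβγ : β = γ := by
      refine StdBasis.eq_of_mem_normalForms hord h.2 hβ hγ fun N => ?_
      obtain ⟨t, ht, hto⟩ := StdBasis.exists_mem_span_of_topRew hab N
      obtain ⟨t', ht', hto'⟩ := StdBasis.exists_mem_span_of_topRew hac N
      refine ⟨(t' - t) + ((∑ s : R, q' s * (s : MvPowerSeries (Fin n) K)) -
        ∑ s : R, q s * (s : MvPowerSeries (Fin n) K)),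
        add_mem (sub_mem ht' ht) (sub_mem (StdBasis.mem_span_iff_exists_sum.mpr ⟨q', rfl⟩)
          (StdBasis.mem_span_iff_exists_sum.mpr ⟨q, rfl⟩)), ?_⟩
      have := sub_mem hto' hto
      rw [hq, hq'] at this
      convert this using 1
      abel
    subst hβγ
    exact ⟨β, StdBasis.ChainRew.topRew hbβ, StdBasis.ChainRew.topRew hcγ⟩
  tfae_have 9 → 1 := fun h a b c hab hac =>
    h a b c (StdBasis.FinRew.topRew hab) (StdBasis.FinRew.topRew hac)
  tfae_finish
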